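/- Let $G=(V,E)$ be a finite simple graph with $n$ vertices. A fractional matching of a graph is a vector $(x_e)$ of non-negative reals indexed by its edges with $\sum_{e\ni v}x_e\le 1$ for every vertex $v$. Let $x$ be a fractional matching of $G$, let $\epsilon\in(0,1/2)$, let $d\ge \frac{4\log(2/\epsilon)}{\epsilon^2}$ be real (natural logarithm), and let $\gamma\ge1$ be an integer. Put $K=\lceil 2\log_{1+\epsilon}(n/\epsilon)\rceil$. Algorithm 1 (Edge-Color and Sparsify) does the following for each $i\in\{1,\dots,K\}$. Let $E_i=\{e\in E: x_e\in((1+\epsilon)^{-i},(1+\epsilon)^{-i+1}]\}$ and $G_i=(V,E_i)$, take any proper edge coloring $\chi_i$ of $G_i$ with a palette of $\gamma\lceil(1+\epsilon)^i\rceil$ colors, and let $S_i$ be a uniformly random set of $\min\{\gamma\lceil d(1+\epsilon)\rceil,\gamma\lceil(1+\epsilon)^i\rceil\}$ colors of the palette (sampled without replacement), where $S_1,\dots,S_K$ are independent. It outputs the random subgraph $H$ of $G$ with vertex set $V$ whose edges are all $e$ such that, for some $i$, $e\in E_i$ and $\chi_i(e)\in S_i$. Then, for every choice of the colorings $\chi_i$,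 the graph $H$ supports a random fractional matching $y$: for each graph $H$ on $V$ there is a fractional matching $y=y(H)$ of $H$ (with $y_e=0$ for $e\notin E(H)$), such that, with expectation over the output $H$ of the algorithm, the following hold. 1. For every edge $e$ with $x_e>(1+\epsilon)^{-K}$ (that is, $e\in E_1\cup\dots\cup E_K$), $\mathbb E[y_e]\ge(1-6\epsilon)\,x_e$. 2. $\mathbb E\big[\sum_e y_e\big]\ge(1-6\epsilon)\sum_{e:\,x_e>(1+\epsilon)^{-K}}x_e$. In particular $\mathbb E[\sum_e y_e]\ge(1-6\epsilon)\sum_e x_e$ whenever every edge with $x_e>0$ lies in one of the classes $E_1,\dots,E_K$. 3. For every fractional matching $x$, $\mathbb E\big[\sum_e y_e\big]\ge(1-6\epsilon)\sum_e x_e-\epsilon^2$. -/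

import Mathlib

namespace EdgeColorSparsify

noncomputable section

/-- `x` is a fractional matching of `G`: a non-negative vector indexed by the edges of `G`
(extended by zero to all unordered pairs) with total value at most one at each vertex. -/
structure IsFractionalMatching {V : Type*} [Fintype V] [DecidableEq V]
    (G : SimpleGraph V) (x : Sym2 V → ℝ) : Prop where
  nonneg : ∀ e, 0 ≤ x e
  eq_zero_of_notMem : ∀ e, e ∉ G.edgeSet → x e = 0
  sum_le_one : ∀ v : V, ∑ e : Sym2 V with v ∈ e, x e ≤ 1

/-- The number `⌈2 log_{1+ε} (n / ε)⌉` of iterations of the algorithm. -/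
def numLevels (n : ℕ) (ε : ℝ) : ℕ := ⌈2 * Real.logb (1 + ε) (n / ε)⌉₊

/-- The size `γ ⌈(1+ε)^i⌉` of the palette in iteration `i`. -/
def numColors (γ : ℕ) (ε : ℝ) (i : ℕ) : ℕ := γ * ⌈(1 + ε) ^ i⌉₊

/-- The number `min {γ ⌈d (1+ε)⌉, γ ⌈(1+ε)^i⌉}` of colors sampled in iteration `i`. -/
def numSamples (γ : ℕ) (d ε : ℝ) (i : ℕ) : ℕ := min (γ * ⌈d * (1 + ε)⌉₊) (numColors γ ε i)

/-- The indices `1, 2, …, numLevels n ε` of the iterations. -/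
abbrev Level (n : ℕ) (ε : ℝ) : Type := Finset.Icc 1 (numLevels n ε)

/-- The edges of `G` with `x`-value in `((1+ε)^{-i}, (1+ε)^{-i+1}]`. -/
def levelEdges {V : Type*} (G : SimpleGraph V) (x : Sym2 V → ℝ) (ε : ℝ) (i : ℕ) :
    Set (Sym2 V) :=
  {e | e ∈ G.edgeSet ∧ x e ∈ Set.Ioc ((1 + ε) ^ (-(i : ℤ))) ((1 + ε) ^ (-(i : ℤ) + 1))}

/-- The subgraph `G_i` of `G` consisting of the edges in `levelEdges G x ε i`. -/
def levelGraph {V : Type*} (G : SimpleGraph V) (x : Sym2 V → ℝ) (ε : ℝ) (i : ℕ) :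
    SimpleGraph V :=
  SimpleGraph.fromEdgeSet (levelEdges G x ε i)

/-- A proper edge coloring of `G` with palette `{0, …, k - 1}` (not every color need be used). -/
abbrev EdgeColoring {V : Type*} (G : SimpleGraph V) (k : ℕ) : Type _ :=
  G.lineGraph.Coloring (Fin k)

/-- One color set for each iteration. -/
abbrev ColorSample (n γ : ℕ) (ε : ℝ) : Type :=
  ∀ i : Level n ε, Finset (Fin (numColors γ ε i))

/-- The possible outcomes of the sampling: in each iteration, a set of exactly
`numSamples γ d ε i` colors of the palette. -/
def outcomes (n γ : ℕ) (d ε : ℝ) : Finset (ColorSample n γ ε) :=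
  Fintype.piFinset fun i : Level n ε =>
    Finset.powersetCard (numSamples γ d ε i) (Finset.univ : Finset (Fin (numColors γ ε i)))

theorem outcomes_nonempty (n γ : ℕ) (d ε : ℝ) : (outcomes n γ d ε).Nonempty := by
  refine Fintype.piFinset_nonempty.2 fun i => Finset.powersetCard_nonempty.2 ?_
  simp [numSamples]

/-- The law of the sampled colors. In each iteration the colors are sampled uniformly without
replacement, independently of the other iterations; that is, the tuple of the sampled sets is
uniform on the product set `outcomes n γ d ε`. -/
def sampleLaw (n γ : ℕ) (d ε : ℝ) : PMF (ColorSample n γ ε) :=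
  PMF.uniformOfFinset (outcomes n γ d ε) (outcomes_nonempty n γ d ε)

/-- The output of the algorithm for given colorings `χ` and sampled colors `S`: the graph on `V`
formed by all edges whose color was sampled. -/
def output {V : Type*} {n γ : ℕ} {ε : ℝ} (G : SimpleGraph V) (x : Sym2 V → ℝ)
    (χ : ∀ i : Level n ε, EdgeColoring (levelGraph G x ε i) (numColors γ ε i))
    (S : ColorSample n γ ε) : SimpleGraph V :=
  SimpleGraph.fromEdgeSet
    {e | ∃ (i : Level n ε) (he : e ∈ (levelGraph G x ε i).edgeSet), χ i ⟨e, he⟩ ∈ S i}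

/-- The law of the random graph `H` output by the algorithm. -/
def outputLaw {V : Type*} {n γ : ℕ} {ε : ℝ} (G : SimpleGraph V) (x : Sym2 V → ℝ) (d : ℝ)
    (χ : ∀ i : Level n ε, EdgeColoring (levelGraph G x ε i) (numColors γ ε i)) :
    PMF (SimpleGraph V) :=
  (sampleLaw n γ d ε).map (output G x χ)

/-- The expectation of `f a` for `a` distributed according to `p`. It is only used for finite
types `α`, on which every function is integrable. -/
def expectation {α : Type*} (p : PMF α) (f : α → ℝ) : ℝ :=
  letI : MeasurableSpace α := ⊤
  ∫ a, f a ∂p.toMeasure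

end

end EdgeColorSparsify

namespace EdgeColorSparsify

open Finset

/-! ### Negative correlation for sampling without replacement. -/

section Counting

/-! Give each edge of H covered by a class the weight w_e = x_e / P(e ∈ H), which has mean x_e, and
divide it by 1 plus the sum of the excesses max(load − 1, 0) at its endpoints. The result is always
a fractional matching. Since 1/(1+t) ≥ 1 − t, the relative loss at e is at most the expected excess
at its two endpoints, conditioned on e ∈ H.

Edges sharing a vertex have distinct class-color pairs, because the colorings are proper
(`HasColor.ne`). Inclusions in a uniform set of fixed size are negatively correlated, even given a
further inclusion, by log-concavity of binomial coefficients (`superCount_mul_le`). So, given e, the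
other edges at a vertex have total mean weight at most the sum of their x-values. The variance is at
most 2/d ≤ ε²: fully sampled classes contribute none, and all other weights are at most 2/d
(`HasColor.inverseWeight_le`). A second moment bound (`sum_mul_excess_le`) limits the excess to ε² +
ε per endpoint, and 2(ε² + ε) ≤ 6ε.

The edges below all classes number at most n² and have value at most (ε/n)² each, whence the
additive ε². -/

theorem choose_log_concave (n k : ℕ) (hk : k ≤ n) :
    n.choose k * (n + 2).choose (k + 2) ≤ (n + 1).choose (k + 1) * (n + 1).choose (k + 1) := by
  have h1 := Nat.add_one_mul_choose_eq n k
  have h2 := Nat.add_one_mul_choose_eq (n + 1) (k + 1)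
  refine le_of_mul_le_mul_left (a := (n + 1) * (k + 2)) ?_ (by positivity)
  calc (n + 1) * (k + 2) * (n.choose k * (n + 2).choose (k + 2))
      = ((n + 1) * n.choose k) * ((n + 2).choose (k + 2) * (k + 2)) := by ring
    _ = ((k + 1) * (n + 2)) * ((n + 1).choose (k + 1) * (n + 1).choose (k + 1)) := by
        rw [h1, show (n + 2).choose (k + 2) * (k + 2) = (n + 2) * (n + 1).choose (k + 1) from
          h2.symm]
        ring
    _ ≤ ((n + 1) * (k + 2)) * ((n + 1).choose (k + 1) * (n + 1).choose (k + 1)) :=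
        Nat.mul_le_mul_right _ (by nlinarith)

/-- The inclusions of two elements in a random set of fixed size are negatively correlated, also
conditionally on the inclusion of a given set. -/
theorem card_powersetCard_superset_mul_le {α : Type*} [Fintype α] [DecidableEq α] (k : ℕ)
    (A : Finset α) {a b : α} (ha : a ∉ A) (hb : b ∉ A) (hab : a ≠ b) :
    #{S ∈ powersetCard k univ | insert a (insert b A) ⊆ S} * #{S ∈ powersetCard k univ | A ⊆ S} ≤
      #{S ∈ powersetCard k univ | insert a A ⊆ S} *
        #{S ∈ powersetCard k univ | insert b A ⊆ S} := by
  have hab' : a ∉ insert b A := by simp [hab, ha]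
  by_cases hk : #A + 2 ≤ k
  · have hcard : #(insert a (insert b A)) = #A + 2 := by
      rw [card_insert_of_notMem hab', card_insert_of_notMem hb]
    have hcard_le := card_le_univ (insert a (insert b A))
    by_cases hk' : k ≤ Fintype.card α
    · rw [card_filter_powersetCard_subset _ _ _ (subset_univ _) (by omega),
        card_filter_powersetCard_subset _ _ _ (subset_univ _) (by omega),
        card_filter_powersetCard_subset _ _ _ (subset_univ _)
          (by rw [card_insert_of_notMem ha]; omega),
        card_filter_powersetCard_subset _ _ _ (subset_univ _)
          (by rw [card_insert_of_notMem hb]; omega), hcard, card_insert_of_notMem ha,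
        card_insert_of_notMem hb, card_univ]
      -- Once `A`, `a` and `b` are removed, `m` counts the elements left to choose and `n` those
      -- left to choose from.
      obtain ⟨m, hm⟩ := Nat.exists_eq_add_of_le hk
      obtain ⟨n, hn⟩ := Nat.exists_eq_add_of_le (hcard ▸ hcard_le)
      have := choose_log_concave n m (by omega)
      rw [hn, hm]
      convert this using 3 <;> omega
    · rw [powersetCard_eq_empty.2 (by simpa using hk')]
      simp
  · have h0 : #{S ∈ powersetCard k univ | insert a (insert b A) ⊆ S} = 0 := by
      rw [card_eq_zero, filter_eq_empty_iff]
      intro S hS hsub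
      have := card_le_card hsub
      rw [card_insert_of_notMem hab', card_insert_of_notMem hb, (mem_powersetCard.1 hS).2] at this
      omega
    simp [h0]

theorem card_powersetCard_mem_mul {α : Type*} [Fintype α] [DecidableEq α] (k : ℕ) (a : α) :
    #{S ∈ powersetCard k univ | a ∈ S} * Fintype.card α =
      k * #(powersetCard k (univ : Finset α)) := by
  have hpos : 0 < Fintype.card α := Fintype.card_pos_iff.2 ⟨a⟩
  rcases Nat.eq_zero_or_pos k with rfl | hk
  · simp
  · have h := card_filter_powersetCard_subset {a} univ k (subset_univ _) (by rwa [card_singleton])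
    simp only [singleton_subset_iff, card_singleton, card_univ] at h
    rw [h, card_powersetCard, card_univ]
    obtain ⟨n, hn⟩ := Nat.exists_eq_add_of_lt hpos
    obtain ⟨m, rfl⟩ := Nat.exists_eq_add_of_lt hk
    have := Nat.add_one_mul_choose_eq n m
    rw [hn]
    simp only [zero_add, Nat.add_sub_cancel]
    linarith

variable {ι : Type*} [DecidableEq ι] {κ : ι → Type*} [∀ i, Fintype (κ i)]
  [∀ i, DecidableEq (κ i)]

/-- The elements of `A` in the `i`-th summand. -/
def slice (A : Finset (Σ i, κ i)) (i : ι) : Finset (κ i) := {c | ⟨i, c⟩ ∈ A}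

theorem slice_insert_self (A : Finset (Σ i, κ i)) (i : ι) (c : κ i) :
    slice (insert ⟨i, c⟩ A) i = insert c (slice A i) := by
  ext c'
  simp [slice]

theorem slice_insert_of_ne (A : Finset (Σ i, κ i)) {i j : ι} (c : κ j) (h : i ≠ j) :
    slice (insert ⟨j, c⟩ A) i = slice A i := by
  ext c'
  simp [slice, h]

variable [Fintype ι]

/-- The number of families of sets, the `i`-th one of size `k i`, that contain `A`. -/
def superCount (k : ι → ℕ) (A : Finset (Σ i, κ i)) : ℕ :=
  #{S ∈ Fintype.piFinset fun i => powersetCard (k i) (univ : Finset (κ i)) |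
    ∀ c ∈ A, c.2 ∈ S c.1}

theorem superCount_eq_prod (k : ι → ℕ) (A : Finset (Σ i, κ i)) :
    superCount k A = ∏ i, #{S ∈ powersetCard (k i) (univ : Finset (κ i)) | slice A i ⊆ S} := by
  rw [superCount, ← Fintype.card_piFinset]
  congr 1
  ext S
  simp only [mem_filter, Fintype.mem_piFinset, slice, subset_iff, mem_univ, true_and,
    Sigma.forall, forall_and]

/-- The counts factor over the summands. Only a summand containing both `a` and `b` gives a genuine
inequality; in every other one the two sides agree. -/
theorem superCount_mul_le (k : ι → ℕ) (A : Finset (Σ i, κ i)) {a b : Σ i, κ i} (ha : a ∉ A)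
    (hb : b ∉ A) (hab : a ≠ b) :
    superCount k (insert a (insert b A)) * superCount k A ≤
      superCount k (insert a A) * superCount k (insert b A) := by
  obtain ⟨i, a⟩ := a
  obtain ⟨j, b⟩ := b
  simp only [superCount_eq_prod, ← prod_mul_distrib]
  refine prod_le_prod' fun l _ => ?_
  by_cases hi : l = i
  · subst hi
    by_cases hj : l = j
    · subst hj
      rw [slice_insert_self, slice_insert_self, slice_insert_self]
      exact card_powersetCard_superset_mul_le _ _ (by simpa [slice] using ha)
        (by simpa [slice] using hb) (by simpa using hab)
    · rw [slice_insert_self, slice_insert_self, slice_insert_of_ne _ _ hj]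
  · rw [slice_insert_of_ne _ _ hi, slice_insert_of_ne _ _ hi, mul_comm]

theorem superCount_singleton_mul (k : ι → ℕ) (a : Σ i, κ i) :
    superCount k {a} * Fintype.card (κ a.1) = k a.1 * superCount k (∅ : Finset (Σ i, κ i)) := by
  obtain ⟨i, a⟩ := a
  rw [superCount_eq_prod, superCount_eq_prod, Fintype.prod_eq_mul_prod_compl i,
    Fintype.prod_eq_mul_prod_compl i, ← insert_empty_eq, slice_insert_self]
  have h : ∀ l ∈ ({i}ᶜ : Finset ι), slice (insert ⟨i, a⟩ (∅ : Finset (Σ i, κ i))) l =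
      slice ∅ l := fun l hl => slice_insert_of_ne _ _ (by simpa using hl)
  rw [prod_congr rfl fun l hl => by rw [h l hl]]
  have he : ∀ l, slice (∅ : Finset (Σ i, κ i)) l = ∅ := fun l => by ext; simp [slice]
  have := card_powersetCard_mem_mul (k i) a
  simp only [he, insert_empty_eq, singleton_subset_iff, empty_subset, filter_true]
  rw [mul_right_comm, this, mul_assoc]

end Counting

/-! ### Second moment bound for the excess load. -/

section SecondMoment

variable {α ι : Type*} [DecidableEq ι]

/-- The second moment of a weighted sum of indicators on the event with indicator `I₀`, if the
indicators are negatively correlated on that event. -/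
theorem sum_mul_sq_le (Ω : Finset α) (F : Finset ι) (I₀ : α → ℝ) (I : ι → α → ℝ)
    (w q : ι → ℝ) (hw : ∀ f ∈ F, 0 ≤ w f) (hI : ∀ f ∈ F, ∀ ω, I f ω * I f ω = I f ω)
    (hq : ∀ f ∈ F, ∑ ω ∈ Ω, I₀ ω * I f ω = q f * ∑ ω ∈ Ω, I₀ ω)
    (hneg : ∀ f ∈ F, ∀ g ∈ F, f ≠ g →
      ∑ ω ∈ Ω, I₀ ω * I f ω * I g ω ≤ q f * q g * ∑ ω ∈ Ω, I₀ ω) :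
    ∑ ω ∈ Ω, I₀ ω * (∑ f ∈ F, w f * (I f ω - q f)) ^ 2 ≤
      ∑ f ∈ F, w f ^ 2 * (q f * (1 - q f)) * ∑ ω ∈ Ω, I₀ ω := by
  set A := ∑ ω ∈ Ω, I₀ ω with hA
  have hterm : ∀ f ∈ F, ∀ g ∈ F, ∑ ω ∈ Ω, I₀ ω * (I f ω - q f) * (I g ω - q g) =
      ∑ ω ∈ Ω, I₀ ω * I f ω * I g ω - q f * q g * A := by
    intro f hf g hg
    calc ∑ ω ∈ Ω, I₀ ω * (I f ω - q f) * (I g ω - q g)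
        = ∑ ω ∈ Ω, I₀ ω * I f ω * I g ω - q g * ∑ ω ∈ Ω, I₀ ω * I f ω
            - q f * ∑ ω ∈ Ω, I₀ ω * I g ω + q f * q g * A := by
          rw [hA, mul_sum, mul_sum, mul_sum, ← sum_sub_distrib, ← sum_sub_distrib,
            ← sum_add_distrib]
          exact sum_congr rfl fun ω _ => by ring
      _ = _ := by rw [hq f hf, hq g hg]; ring
  calc ∑ ω ∈ Ω, I₀ ω * (∑ f ∈ F, w f * (I f ω - q f)) ^ 2
      = ∑ f ∈ F, ∑ g ∈ F, w f * w g * ∑ ω ∈ Ω, I₀ ω * (I f ω - q f) * (I g ω - q g) := by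
        simp_rw [sq, sum_mul_sum, mul_sum]
        rw [sum_comm]
        refine sum_congr rfl fun f _ => ?_
        rw [sum_comm]
        exact sum_congr rfl fun g _ => sum_congr rfl fun ω _ => by ring
    _ ≤ ∑ f ∈ F, ∑ g ∈ F, if f = g then w f ^ 2 * (q f * (1 - q f)) * A else 0 := by
        refine sum_le_sum fun f hf => sum_le_sum fun g hg => ?_
        rw [hterm f hf g hg]
        -- The diagonal gives the Bernoulli variance `q f - q f ^ 2`; negative correlation discards
        -- the rest.
        split_ifs with h
        · subst h
          have : ∑ ω ∈ Ω, I₀ ω * I f ω * I f ω = q f * A := by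
            rw [← hq f hf]
            exact sum_congr rfl fun ω _ => by rw [mul_assoc, hI f hf]
          rw [this]
          exact le_of_eq (by ring)
        · exact mul_nonpos_of_nonneg_of_nonpos (mul_nonneg (hw f hf) (hw g hg))
            (sub_nonpos.2 (hneg f hf g hg h))
    _ = ∑ f ∈ F, w f ^ 2 * (q f * (1 - q f)) * A :=
        sum_congr rfl fun f hf => by rw [sum_ite_eq, if_pos hf]

/-- The expected excess over `1` of a weighted sum of indicators with mean at most `1`, on the
event with indicator `I e`. Each indicator is either constant or has a small weight. -/
theorem sum_mul_excess_le (Ω : Finset α) (F : Finset ι) (I : ι → α → ℝ) (x w : ι → ℝ) (e : ι)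
    (he : e ∈ F) (b ε : ℝ) (hε : 0 < ε) (hb : b ≤ ε ^ 2) (hb0 : 0 ≤ b)
    (hI : ∀ f ∈ F, ∀ ω, I f ω = 0 ∨ I f ω = 1)
    (hx : ∀ f ∈ F, 0 ≤ x f) (hxsum : ∑ f ∈ F, x f ≤ 1)
    (hw : ∀ f ∈ F, 0 ≤ w f) (hwx : ∀ f ∈ F, w f * ∑ ω ∈ Ω, I f ω = x f * #Ω)
    (hsmall : ∀ f ∈ F, (∀ ω ∈ Ω, I f ω = 1) ∨ w f ≤ b)
    (hpos : 0 < ∑ ω ∈ Ω, I e ω)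
    (hpair : ∀ f ∈ F, f ≠ e →
      (∑ ω ∈ Ω, I e ω * I f ω) * #Ω ≤ (∑ ω ∈ Ω, I e ω) * ∑ ω ∈ Ω, I f ω)
    (htriple : ∀ f ∈ F, ∀ g ∈ F, f ≠ e → g ≠ e → f ≠ g →
      (∑ ω ∈ Ω, I e ω * I f ω * I g ω) * ∑ ω ∈ Ω, I e ω ≤
        (∑ ω ∈ Ω, I e ω * I f ω) * ∑ ω ∈ Ω, I e ω * I g ω) :
    ∑ ω ∈ Ω, I e ω * max (∑ f ∈ F, w f * I f ω - 1) 0 ≤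
      (ε ^ 2 + ε) * ∑ ω ∈ Ω, I e ω := by
  set A := ∑ ω ∈ Ω, I e ω with hA
  have hΩ : (0 : ℝ) < #Ω := by
    rcases Ω.eq_empty_or_nonempty with rfl | h
    · simp [hA] at hpos
    · exact_mod_cast h.card_pos
  have hI0 : ∀ f ∈ F, ∀ ω, 0 ≤ I f ω := fun f hf ω => by
    rcases hI f hf ω with h | h <;> simp [h]
  -- The probability of `f` conditioned on `e`.
  set q : ι → ℝ := fun f => (∑ ω ∈ Ω, I e ω * I f ω) / A with hqdef
  have hq : ∀ f, ∑ ω ∈ Ω, I e ω * I f ω = q f * A := fun f => by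
    rw [hqdef]; field_simp
  have hq0 : ∀ f ∈ F, 0 ≤ q f := fun f hf =>
    div_nonneg (sum_nonneg fun ω _ => mul_nonneg (hI0 e he ω) (hI0 f hf ω)) hpos.le
  have hwq : ∀ f ∈ F.erase e, w f * q f ≤ x f := by
    intro f hf
    have hfF := mem_of_mem_erase hf
    have h1 := hpair f hfF (ne_of_mem_erase hf)
    rw [hq f] at h1
    have h2 : q f * #Ω ≤ ∑ ω ∈ Ω, I f ω := by
      refine le_of_mul_le_mul_left ?_ hpos
      linarith
    refine le_of_mul_le_mul_right ?_ hΩ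
    rw [← hwx f hfF, mul_assoc]
    exact mul_le_mul_of_nonneg_left h2 (hw f hfF)
  have hconst : ∀ f ∈ F, (∀ ω ∈ Ω, I f ω = 1) → q f = 1 := by
    intro f hf h
    have : ∑ ω ∈ Ω, I e ω * I f ω = A := sum_congr rfl fun ω hω => by rw [h ω hω, mul_one]
    rw [hqdef]
    simp only [this]
    exact div_self hpos.ne'
  -- Conditioning on `e` raises its own contribution from mean `x e` to `w e`; this costs nothing if
  -- `e` is always present, and at most `b` otherwise.
  have hwe : w e - x e ≤ b := by
    rcases hsmall e he with h | h
    · have h1 := hwx e he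
      rw [sum_congr rfl h, sum_const, nsmul_eq_mul, mul_one] at h1
      rw [mul_right_cancel₀ hΩ.ne' h1, sub_self]
      exact hb0
    · linarith [hx e he]
  have hsq := sum_mul_sq_le Ω (F.erase e) (I e) I w q
    (fun f hf => hw f (mem_of_mem_erase hf))
    (fun f hf ω => by rcases hI f (mem_of_mem_erase hf) ω with h | h <;> simp [h])
    (fun f _ => hq f)
    (fun f hf g hg hfg => by
      have := htriple f (mem_of_mem_erase hf) g (mem_of_mem_erase hg) (ne_of_mem_erase hf)
        (ne_of_mem_erase hg) hfg
      rw [hq f, hq g] at this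
      refine le_of_mul_le_mul_right (this.trans_eq ?_) hpos
      ring)
  rw [← hA] at hsq
  have hvar : ∑ f ∈ F.erase e, w f ^ 2 * (q f * (1 - q f)) * A ≤ b * A := by
    rw [← sum_mul]
    refine mul_le_mul_of_nonneg_right ?_ hpos.le
    calc ∑ f ∈ F.erase e, w f ^ 2 * (q f * (1 - q f))
        ≤ ∑ f ∈ F.erase e, b * x f := by
          refine sum_le_sum fun f hf => ?_
          have hfF := mem_of_mem_erase hf
          rcases hsmall f hfF with h | h
          · rw [hconst f hfF h]
            simpa using mul_nonneg hb0 (hx f hfF)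
          · calc w f ^ 2 * (q f * (1 - q f)) ≤ w f ^ 2 * q f := by
                  refine mul_le_mul_of_nonneg_left ?_ (sq_nonneg _)
                  nlinarith [hq0 f hfF]
              _ = w f * (w f * q f) := by ring
              _ ≤ b * x f := mul_le_mul h (hwq f hf)
                  (mul_nonneg (hw f hfF) (hq0 f hfF)) hb0
      _ ≤ ∑ f ∈ F, b * x f := sum_le_sum_of_subset_of_nonneg (erase_subset _ _)
          fun f hf _ => mul_nonneg hb0 (hx f hf)
      _ ≤ b := by rw [← mul_sum]; exact mul_le_of_le_one_right hb0 hxsum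
  have hpoint : ∀ ω, I e ω * max (∑ f ∈ F, w f * I f ω - 1) 0 ≤
      I e ω * (b + ε / 2) + I e ω * (∑ f ∈ F.erase e, w f * (I f ω - q f)) ^ 2 * (1 / (2 * ε)) := by
    intro ω
    set T := ∑ f ∈ F.erase e, w f * (I f ω - q f) with hT
    rcases hI e he ω with h | h
    · simp [h]
    -- AM-GM with parameter `ε` replaces Cauchy-Schwarz, so no square root of the variance appears.
    · have hTabs : T ≤ ε / 2 + T ^ 2 * (1 / (2 * ε)) := by
        have : ε / 2 + T ^ 2 * (1 / (2 * ε)) - T = (T - ε) ^ 2 / (2 * ε) := by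
          field_simp; ring
        have : 0 ≤ (T - ε) ^ 2 / (2 * ε) := by positivity
        linarith
      have hle : ∑ f ∈ F, w f * I f ω - 1 ≤ b + T := by
        rw [← add_sum_erase F _ he, h, mul_one]
        rw [← add_sum_erase F _ he] at hxsum
        have : ∑ f ∈ F.erase e, w f * I f ω ≤ T + ∑ f ∈ F.erase e, x f := by
          rw [hT, ← sum_add_distrib]
          exact sum_le_sum fun f hf => by linarith [hwq f hf]
        linarith
      rw [h, one_mul, one_mul, one_mul]
      refine max_le (by linarith) ?_
      positivity
  calc ∑ ω ∈ Ω, I e ω * max (∑ f ∈ F, w f * I f ω - 1) 0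
      ≤ ∑ ω ∈ Ω, (I e ω * (b + ε / 2) +
          I e ω * (∑ f ∈ F.erase e, w f * (I f ω - q f)) ^ 2 * (1 / (2 * ε))) :=
        sum_le_sum fun ω _ => hpoint ω
    _ = A * (b + ε / 2) +
          (∑ ω ∈ Ω, I e ω * (∑ f ∈ F.erase e, w f * (I f ω - q f)) ^ 2) * (1 / (2 * ε)) := by
        rw [sum_add_distrib, sum_mul, sum_mul]
    _ ≤ A * (ε ^ 2 + ε / 2) + (ε ^ 2 * A) * (1 / (2 * ε)) := by
        have : b * A ≤ ε ^ 2 * A := mul_le_mul_of_nonneg_right hb hpos.le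
        gcongr
        linarith
    _ = (ε ^ 2 + ε) * A := by field_simp; ring

end SecondMoment

/-! ### Repairing overloaded vertices. -/

section Matching

variable {V : Type*} [Fintype V] [DecidableEq V]

open Classical in
/-- The total weight at `v` of the edges of `H`. -/
noncomputable def load (w : Sym2 V → ℝ) (H : SimpleGraph V) (v : V) : ℝ :=
  ∑ e : Sym2 V with v ∈ e, w e * if e ∈ H.edgeSet then 1 else 0

open Classical in
/-- The weights of the edges of `H`, scaled down at the endpoints whose load exceeds one. -/
noncomputable def scaledWeight (w : Sym2 V → ℝ) (H : SimpleGraph V) (e : Sym2 V) : ℝ :=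
  (w e * if e ∈ H.edgeSet then 1 else 0) / (1 + ∑ v with v ∈ e, max (load w H v - 1) 0)

theorem sum_max_nonneg (w : Sym2 V → ℝ) (H : SimpleGraph V) (e : Sym2 V) :
    0 ≤ ∑ v with v ∈ e, max (load w H v - 1) 0 :=
  sum_nonneg fun _ _ => le_max_right _ _

/-- Every edge at `v` is divided by at least 1 plus the excess at `v`, which already bounds the load
there. -/
theorem isFractionalMatching_scaledWeight (w : Sym2 V → ℝ) (hw : ∀ e, 0 ≤ w e)
    (H : SimpleGraph V) : IsFractionalMatching H (scaledWeight w H) where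
  nonneg e := by
    have := sum_max_nonneg w H e
    have := hw e
    unfold scaledWeight
    positivity
  eq_zero_of_notMem e he := by simp [scaledWeight, he]
  sum_le_one v := by
    classical
    set m := max (load w H v - 1) 0
    have hm : 0 ≤ m := le_max_right _ _
    have hload : load w H v ≤ 1 + m := by linarith [le_max_left (load w H v - 1) 0]
    calc ∑ e : Sym2 V with v ∈ e, scaledWeight w H e
        ≤ ∑ e : Sym2 V with v ∈ e, (w e * if e ∈ H.edgeSet then 1 else 0) / (1 + m) := by
          refine sum_le_sum fun e he => ?_
          have hle : m ≤ ∑ v with v ∈ e, max (load w H v - 1) 0 :=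
            single_le_sum (f := fun v => max (load w H v - 1) 0)
              (fun _ _ => le_max_right _ _) (by simpa using he)
          have := hw e
          unfold scaledWeight
          gcongr
      _ = load w H v / (1 + m) := by rw [← sum_div, load]
      _ ≤ 1 := (div_le_one (by linarith)).2 hload

/-- From 1/(1+t) ≥ 1 − t. The bound is linear in the excesses, so it can be averaged one endpoint at
a time; `c` stands for the indicator of `e`. -/
theorem le_scaledWeight (w : Sym2 V → ℝ) (hw : ∀ e, 0 ≤ w e) (H : SimpleGraph V) (e : Sym2 V)
    (c : ℝ) (hc : c = 0 ∨ c = 1) (hce : c = 1 → e ∈ H.edgeSet) :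
    w e * (c - ∑ v with v ∈ e, c * max (load w H v - 1) 0) ≤ scaledWeight w H e := by
  rcases hc with rfl | rfl
  · simpa using (isFractionalMatching_scaledWeight w hw H).nonneg e
  · have h0 := sum_max_nonneg w H e
    simp only [one_mul]
    rw [scaledWeight, if_pos (hce rfl), mul_one, div_eq_mul_inv]
    refine mul_le_mul_of_nonneg_left ?_ (hw e)
    rw [← one_div, le_div_iff₀ (by linarith)]
    nlinarith

end Matching

/-! ### Classes, colors, weights and sampling probabilities. -/

section Algorithm

variable {V : Type*} {γ : ℕ} {d ε : ℝ} {n : ℕ} {G : SimpleGraph V} {x : Sym2 V → ℝ}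

theorem expectation_outputLaw (χ : ∀ i : Level n ε, EdgeColoring (levelGraph G x ε i)
    (numColors γ ε i)) (f : SimpleGraph V → ℝ) :
    expectation (outputLaw G x d χ) f =
      (∑ S ∈ outcomes n γ d ε, f (output G x χ S)) / #(outcomes n γ d ε) := by
  let _ : MeasurableSpace (SimpleGraph V) := ⊤
  let _ : MeasurableSpace (ColorSample n γ ε) := ⊤
  have : MeasurableSingletonClass (ColorSample n γ ε) := ⟨fun _ => trivial⟩
  have hmeas : Measurable (output G x χ : ColorSample n γ ε → SimpleGraph V) :=
    fun _ _ => trivial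
  have hf : Measurable f := fun _ _ => trivial
  calc expectation (outputLaw G x d χ) f
      = ∫ H, f H ∂((sampleLaw n γ d ε).map (output G x χ)).toMeasure := rfl
    _ = ∫ S, f (output G x χ S) ∂(sampleLaw n γ d ε).toMeasure := by
        rw [← PMF.toMeasure_map (output G x χ) (sampleLaw n γ d ε) hmeas,
          MeasureTheory.integral_map hmeas.aemeasurable hf.aestronglyMeasurable]
    _ = _ := by
        rw [PMF.integral_eq_sum, sum_div, ← sum_subset (subset_univ (outcomes n γ d ε))]
        · refine sum_congr rfl fun S hS => ?_
          rw [sampleLaw, PMF.uniformOfFinset_apply_of_mem _ hS]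
          simp [div_eq_inv_mul]
        · intro S _ hS
          rw [sampleLaw, PMF.uniformOfFinset_apply_of_notMem _ hS]
          simp

theorem mem_edgeSet_levelGraph {i : ℕ} {e : Sym2 V} :
    e ∈ (levelGraph G x ε i).edgeSet ↔ e ∈ levelEdges G x ε i := by
  rw [levelGraph, SimpleGraph.edgeSet_fromEdgeSet]
  exact ⟨fun h => h.1, fun h => ⟨h, G.not_isDiag_of_mem_edgeSet h.1⟩⟩

theorem le_of_mem_levelEdges (hε : 0 < ε) {i j : ℕ} {e : Sym2 V} (hi : e ∈ levelEdges G x ε i)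
    (hj : e ∈ levelEdges G x ε j) : i ≤ j := by
  have h := (zpow_lt_zpow_iff_right₀ (by linarith : 1 < 1 + ε)).1 (hj.2.1.trans_le hi.2.2)
  omega

theorem level_unique (hε : 0 < ε) {i j : ℕ} {e : Sym2 V} (hi : e ∈ levelEdges G x ε i)
    (hj : e ∈ levelEdges G x ε j) : i = j :=
  le_antisymm (le_of_mem_levelEdges hε hi hj) (le_of_mem_levelEdges hε hj hi)

theorem exists_level (hε : 0 < ε) {K : ℕ} {e : Sym2 V} (he : e ∈ G.edgeSet) (hx : x e ≤ 1)
    (hK : (1 + ε) ^ (-(K : ℤ)) < x e) : ∃ i ∈ Icc 1 K, e ∈ levelEdges G x ε i := by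
  have h1 : 1 < 1 + ε := by linarith
  have hpos : 0 < x e := lt_trans (by positivity) hK
  obtain ⟨m, hm, hm'⟩ := exists_nat_pow_near_of_lt_one hpos hx (inv_pos.2 (by linarith))
    (inv_lt_one_of_one_lt₀ h1)
  have hm₁ : (1 + ε) ^ (-((m + 1 : ℕ) : ℤ)) < x e := by
    rwa [zpow_neg, zpow_natCast, ← inv_pow]
  have hm₂ : x e ≤ (1 + ε) ^ (-((m + 1 : ℕ) : ℤ) + 1) := by
    rwa [show -((m + 1 : ℕ) : ℤ) + 1 = -(m : ℤ) by push_cast; ring, zpow_neg, zpow_natCast,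
      ← inv_pow]
  -- The shift by one matches the convention that class `i` ends at `(1 + ε) ^ (-i + 1)`.
  refine ⟨m + 1, mem_Icc.2 ⟨by omega, ?_⟩, he, hm₁, hm₂⟩
  have := (zpow_lt_zpow_iff_right₀ h1).1 (hK.trans_le hm₂)
  omega

/-- The edge `e` lies in the class `c.1` and has color `c.2` there. -/
def HasColor (χ : ∀ i : Level n ε, EdgeColoring (levelGraph G x ε i) (numColors γ ε i))
    (e : Sym2 V) (c : Σ i : Level n ε, Fin (numColors γ ε i)) : Prop :=
  ∃ he : e ∈ (levelGraph G x ε c.1).edgeSet, χ c.1 ⟨e, he⟩ = c.2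

variable {χ : ∀ i : Level n ε, EdgeColoring (levelGraph G x ε i) (numColors γ ε i)}

theorem HasColor.mem_output_iff (hε : 0 < ε) {e : Sym2 V}
    {c : Σ i : Level n ε, Fin (numColors γ ε i)} (h : HasColor χ e c) (S : ColorSample n γ ε) :
    e ∈ (output G x χ S).edgeSet ↔ c.2 ∈ S c.1 := by
  obtain ⟨i, a⟩ := c
  obtain ⟨he, h⟩ := h
  dsimp only at he h ⊢
  rw [← h, output, SimpleGraph.edgeSet_fromEdgeSet]
  constructor
  · rintro ⟨⟨j, hj, hS⟩, -⟩
    obtain rfl : i = j := Subtype.ext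
      (level_unique hε (mem_edgeSet_levelGraph.1 he) (mem_edgeSet_levelGraph.1 hj))
    exact hS
  · exact fun hS => ⟨⟨i, he, hS⟩, SimpleGraph.not_isDiag_of_mem_edgeSet _ he⟩

/-- The only use of properness: distinct edges at a vertex are governed by distinct elements of the
sampled ground set. -/
theorem HasColor.ne {e f : Sym2 V} {c c' : Σ i : Level n ε, Fin (numColors γ ε i)}
    (h : HasColor χ e c) (h' : HasColor χ f c') (hef : e ≠ f) {v : V} (hve : v ∈ e)
    (hvf : v ∈ f) : c ≠ c' := by
  rintro rfl
  obtain ⟨he, h⟩ := h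
  obtain ⟨hf, h'⟩ := h'
  refine (χ c.1).valid (SimpleGraph.lineGraph_adj_iff_exists.2 ⟨?_, v, hve, hvf⟩)
    (h.trans h'.symm)
  simpa using hef

open Classical in
/-- The value `x e` divided by the probability that the color of `e` is sampled, or zero if `e` is
in none of the classes. -/
noncomputable def inverseWeight (G : SimpleGraph V) (x : Sym2 V → ℝ) (n γ : ℕ) (d ε : ℝ)
    (e : Sym2 V) : ℝ :=
  if h : ∃ i : Level n ε, e ∈ levelEdges G x ε i then
    x e * numColors γ ε h.choose / numSamples γ d ε h.choose
  else 0

theorem inverseWeight_nonneg (hx : ∀ e, 0 ≤ x e) (e : Sym2 V) :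
    0 ≤ inverseWeight G x n γ d ε e := by
  have := hx e
  unfold inverseWeight
  split_ifs <;> positivity

theorem exists_hasColor_of_inverseWeight_ne_zero
    (χ : ∀ i : Level n ε, EdgeColoring (levelGraph G x ε i) (numColors γ ε i)) {e : Sym2 V}
    (he : inverseWeight G x n γ d ε e ≠ 0) : ∃ c, HasColor χ e c := by
  by_contra! h
  refine he (dif_neg ?_)
  rintro ⟨i, hi⟩
  exact h ⟨i, χ i ⟨e, mem_edgeSet_levelGraph.2 hi⟩⟩ ⟨mem_edgeSet_levelGraph.2 hi, rfl⟩

theorem HasColor.inverseWeight_eq (hε : 0 < ε) {e : Sym2 V}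
    {c : Σ i : Level n ε, Fin (numColors γ ε i)} (h : HasColor χ e c) :
    inverseWeight G x n γ d ε e = x e * numColors γ ε c.1 / numSamples γ d ε c.1 := by
  have hex : ∃ i : Level n ε, e ∈ levelEdges G x ε i := ⟨c.1, mem_edgeSet_levelGraph.1 h.choose⟩
  have : (hex.choose : ℕ) = c.1 :=
    level_unique hε hex.choose_spec (mem_edgeSet_levelGraph.1 h.choose)
  rw [inverseWeight, dif_pos hex, this]

theorem numColors_pos (hε : 0 < ε) (hγ : 1 ≤ γ) (i : ℕ) : 0 < numColors γ ε i :=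
  Nat.mul_pos hγ (Nat.ceil_pos.2 (by positivity))

theorem numSamples_pos (hε : 0 < ε) (hd : 0 < d) (hγ : 1 ≤ γ) (i : ℕ) :
    0 < numSamples γ d ε i :=
  lt_min (Nat.mul_pos hγ (Nat.ceil_pos.2 (by positivity))) (numColors_pos hε hγ i)

/-- In a class where not all colors are sampled, the weights are small. -/
theorem HasColor.inverseWeight_le (hε : 0 < ε) (hd : 0 < d) (hγ : 1 ≤ γ) {e : Sym2 V}
    {c : Σ i : Level n ε, Fin (numColors γ ε i)} (h : HasColor χ e c)
    (hc : numSamples γ d ε c.1 ≠ numColors γ ε c.1) :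
    inverseWeight G x n γ d ε e ≤ 2 / d := by
  rw [h.inverseWeight_eq hε]
  obtain ⟨i, a⟩ := c
  have he := (mem_edgeSet_levelGraph.1 h.choose).2.2
  dsimp only at he hc ⊢
  have hs : numSamples γ d ε i = γ * ⌈d * (1 + ε)⌉₊ := by
    rcases min_choice (γ * ⌈d * (1 + ε)⌉₊) (numColors γ ε i) with h | h
    · exact h
    · exact absurd h hc
  have hγ' : (0 : ℝ) < γ := by exact_mod_cast hγ
  have h1 : 1 ≤ (1 + ε) ^ (i : ℕ) := one_le_pow₀ (by linarith)
  -- Rounding up at most doubles a number that is at least 1; this is the 2 in `2 / d`.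
  have hceil : (⌈(1 + ε) ^ (i : ℕ)⌉₊ : ℝ) ≤ 2 * (1 + ε) ^ (i : ℕ) := by
    linarith [Nat.ceil_lt_add_one (zero_le_one.trans h1)]
  have hceil' : d * (1 + ε) ≤ ⌈d * (1 + ε)⌉₊ := Nat.le_ceil _
  have hdε : 0 < d * (1 + ε) := by positivity
  have hxc : x e * ⌈(1 + ε) ^ (i : ℕ)⌉₊ ≤ 2 * (1 + ε) := by
    calc x e * ⌈(1 + ε) ^ (i : ℕ)⌉₊
        ≤ (1 + ε) ^ (-((i : ℕ) : ℤ) + 1) * (2 * (1 + ε) ^ (i : ℕ)) := by gcongr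
      _ = 2 * (1 + ε) := by
        rw [zpow_add₀ (by positivity), zpow_neg, zpow_natCast, zpow_one]
        field_simp
  rw [hs, numColors]
  push_cast
  calc x e * (γ * ⌈(1 + ε) ^ (i : ℕ)⌉₊) / (γ * ⌈d * (1 + ε)⌉₊)
      = (x e * ⌈(1 + ε) ^ (i : ℕ)⌉₊) / ⌈d * (1 + ε)⌉₊ := by
        rw [mul_left_comm, mul_div_mul_left _ _ hγ'.ne']
    _ ≤ (2 * (1 + ε)) / (d * (1 + ε)) := by gcongr
    _ = 2 / d := mul_div_mul_right _ _ (by positivity)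

open Classical in
/-- The indicator of the event that `e` is an edge of the output. -/
noncomputable def edgeIndicator
    (χ : ∀ i : Level n ε, EdgeColoring (levelGraph G x ε i) (numColors γ ε i))
    (e : Sym2 V) (S : ColorSample n γ ε) : ℝ :=
  if e ∈ (output G x χ S).edgeSet then 1 else 0

theorem edgeIndicator_eq_zero_or_one (e : Sym2 V) (S : ColorSample n γ ε) :
    edgeIndicator χ e S = 0 ∨ edgeIndicator χ e S = 1 := by
  unfold edgeIndicator
  split_ifs <;> simp

theorem HasColor.edgeIndicator_eq (hε : 0 < ε) {e : Sym2 V}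
    {c : Σ i : Level n ε, Fin (numColors γ ε i)} (h : HasColor χ e c) (S : ColorSample n γ ε) :
    edgeIndicator χ e S = if c.2 ∈ S c.1 then 1 else 0 := by
  classical
  unfold edgeIndicator
  exact if_congr (h.mem_output_iff hε S) rfl rfl

/-- The number of outcomes that contain all colors in `A`. -/
noncomputable def sampleCount (d : ℝ) (A : Finset (Σ i : Level n ε, Fin (numColors γ ε i))) : ℕ :=
  superCount (fun i : Level n ε => numSamples γ d ε i) A

theorem sampleCount_eq_sum (A : Finset (Σ i : Level n ε, Fin (numColors γ ε i))) :
    (sampleCount d A : ℝ) =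
      ∑ S ∈ outcomes n γ d ε, if ∀ c ∈ A, c.2 ∈ S c.1 then (1 : ℝ) else 0 := by
  rw [sum_boole]
  rfl

theorem sampleCount_empty :
    sampleCount d (∅ : Finset (Σ i : Level n ε, Fin (numColors γ ε i))) =
      #(outcomes n γ d ε) := by
  simp [sampleCount, superCount, outcomes]

theorem HasColor.sum_edgeIndicator (hε : 0 < ε) {e : Sym2 V}
    {c : Σ i : Level n ε, Fin (numColors γ ε i)} (h : HasColor χ e c) :
    ∑ S ∈ outcomes n γ d ε, edgeIndicator χ e S = sampleCount d {c} := by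
  rw [sampleCount_eq_sum]
  exact sum_congr rfl fun S _ => by simp [h.edgeIndicator_eq hε]

theorem HasColor.sum_edgeIndicator_mul (hε : 0 < ε) {e f : Sym2 V}
    {c c' : Σ i : Level n ε, Fin (numColors γ ε i)} (h : HasColor χ e c) (h' : HasColor χ f c') :
    ∑ S ∈ outcomes n γ d ε, edgeIndicator χ e S * edgeIndicator χ f S =
      sampleCount d {c', c} := by
  rw [sampleCount_eq_sum]
  refine sum_congr rfl fun S _ => ?_
  simp only [h.edgeIndicator_eq hε, h'.edgeIndicator_eq hε, forall_mem_insert,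
    mem_singleton, forall_eq]
  split_ifs <;> simp_all

/-- The color of `e` comes last, so that `superCount_mul_le` applies with `A = {c}`, that is,
conditionally on `e`. -/
theorem HasColor.sum_edgeIndicator_mul_mul (hε : 0 < ε) {e f g : Sym2 V}
    {c c' c'' : Σ i : Level n ε, Fin (numColors γ ε i)} (h : HasColor χ e c)
    (h' : HasColor χ f c') (h'' : HasColor χ g c'') :
    ∑ S ∈ outcomes n γ d ε, edgeIndicator χ e S * edgeIndicator χ f S * edgeIndicator χ g S =
      sampleCount d {c', c'', c} := by
  rw [sampleCount_eq_sum]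
  refine sum_congr rfl fun S _ => ?_
  simp only [h.edgeIndicator_eq hε, h'.edgeIndicator_eq hε, h''.edgeIndicator_eq hε,
    forall_mem_insert, mem_singleton, forall_eq]
  split_ifs <;> simp_all

theorem sampleCount_singleton_mul (c : Σ i : Level n ε, Fin (numColors γ ε i)) :
    sampleCount d {c} * numColors γ ε c.1 = numSamples γ d ε c.1 * #(outcomes n γ d ε) := by
  rw [← sampleCount_empty, ← Fintype.card_fin (numColors γ ε c.1)]
  exact superCount_singleton_mul (fun i : Level n ε => numSamples γ d ε i) c

theorem HasColor.inverseWeight_mul_sum (hε : 0 < ε) (hd : 0 < d) (hγ : 1 ≤ γ) {e : Sym2 V}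
    {c : Σ i : Level n ε, Fin (numColors γ ε i)} (h : HasColor χ e c) :
    inverseWeight G x n γ d ε e * ∑ S ∈ outcomes n γ d ε, edgeIndicator χ e S =
      x e * #(outcomes n γ d ε) := by
  have hs : (0 : ℝ) < numSamples γ d ε c.1 := by exact_mod_cast numSamples_pos hε hd hγ _
  have hcount : (sampleCount d {c} : ℝ) * numColors γ ε c.1 =
      numSamples γ d ε c.1 * #(outcomes n γ d ε) := by
    exact_mod_cast sampleCount_singleton_mul c
  rw [h.sum_edgeIndicator hε, h.inverseWeight_eq hε, div_mul_eq_mul_div, div_eq_iff hs.ne',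
    mul_assoc, mul_comm (numColors γ ε c.1 : ℝ), hcount]
  ring

theorem HasColor.sum_edgeIndicator_pos (hε : 0 < ε) (hd : 0 < d) (hγ : 1 ≤ γ) {e : Sym2 V}
    {c : Σ i : Level n ε, Fin (numColors γ ε i)} (h : HasColor χ e c) :
    0 < ∑ S ∈ outcomes n γ d ε, edgeIndicator χ e S := by
  rw [h.sum_edgeIndicator hε, Nat.cast_pos]
  refine Nat.pos_of_mul_pos_right (b := numColors γ ε c.1) ?_
  rw [sampleCount_singleton_mul]
  exact Nat.mul_pos (numSamples_pos hε hd hγ _) (outcomes_nonempty _ _ _ _).card_pos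

theorem HasColor.edgeIndicator_eq_one (hε : 0 < ε) {e : Sym2 V}
    {c : Σ i : Level n ε, Fin (numColors γ ε i)} (h : HasColor χ e c)
    (hc : numSamples γ d ε c.1 = numColors γ ε c.1) {S : ColorSample n γ ε}
    (hS : S ∈ outcomes n γ d ε) : edgeIndicator χ e S = 1 := by
  have hcard := (mem_powersetCard.1 (Fintype.mem_piFinset.1 hS c.1)).2
  have : S c.1 = univ := by
    rw [← card_eq_iff_eq_univ, hcard, hc, Fintype.card_fin]
  rw [h.edgeIndicator_eq hε, this, if_pos (mem_univ _)]

/-- The factor 2 in the number of classes produces the square, which pays for the roughly n² pairs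
in `sum_small_le`. -/
theorem zpow_neg_numLevels_le (hε : 0 < ε) (hn : 0 < n) :
    (1 + ε) ^ (-(numLevels n ε : ℤ)) ≤ (ε / n) ^ 2 := by
  have hn' : (0 : ℝ) < n := by exact_mod_cast hn
  have h1 : 1 < 1 + ε := by linarith
  have hK : Real.logb (1 + ε) ((n / ε) ^ 2) ≤ numLevels n ε := by
    rw [Real.logb_pow]
    exact_mod_cast Nat.le_ceil (2 * Real.logb (1 + ε) (n / ε))
  rw [Real.logb_le_iff_le_rpow h1 (by positivity), Real.rpow_natCast] at hK
  rw [zpow_neg, zpow_natCast, ← inv_div (n : ℝ) ε, inv_pow]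
  exact inv_anti₀ (by positivity) hK

end Algorithm

/-! ### Expected loss per edge and the leftover edges. -/

section Expectation

/-- The edges in none of the classes have a small total value. -/
theorem sum_small_le {V : Type*} [Fintype V] {x : Sym2 V → ℝ} {ε : ℝ}
    (hε : 0 < ε) :
    ∑ e : Sym2 V with ¬ (1 + ε) ^ (-(numLevels (Fintype.card V) ε : ℤ)) < x e, x e ≤ ε ^ 2 := by
  rcases isEmpty_or_nonempty V with hV | hV
  · simp [univ_eq_empty, sq_nonneg]
  · set m := Fintype.card V
    have hm : 0 < m := Fintype.card_pos
    have hm' : (0 : ℝ) < m := by exact_mod_cast hm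
    have hcard : Fintype.card (Sym2 V) ≤ m ^ 2 := by
      have := Fintype.card_le_of_surjective (Sym2.mk.uncurry : V × V → Sym2 V) Sym2.mk_surjective
      rwa [Fintype.card_prod, ← sq] at this
    calc ∑ e : Sym2 V with ¬ (1 + ε) ^ (-(numLevels m ε : ℤ)) < x e, x e
        ≤ ∑ e : Sym2 V with ¬ (1 + ε) ^ (-(numLevels m ε : ℤ)) < x e, (ε / m) ^ 2 :=
          sum_le_sum fun e he =>
            (not_lt.1 (mem_filter.1 he).2).trans (zpow_neg_numLevels_le hε hm)
      _ ≤ ∑ e : Sym2 V, (ε / m) ^ 2 :=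
          sum_le_sum_of_subset_of_nonneg (filter_subset _ _) fun _ _ _ => sq_nonneg _
      _ ≤ (m : ℝ) ^ 2 * (ε / m) ^ 2 := by
          rw [sum_const, nsmul_eq_mul, card_univ]
          have : (Fintype.card (Sym2 V) : ℝ) ≤ (m : ℝ) ^ 2 := by exact_mod_cast hcard
          gcongr
      _ = ε ^ 2 := by field_simp

variable {V : Type*} [Fintype V] [DecidableEq V] {γ : ℕ} {d ε : ℝ} {n : ℕ} {G : SimpleGraph V}
  {x : Sym2 V → ℝ}
  {χ : ∀ i : Level n ε, EdgeColoring (levelGraph G x ε i) (numColors γ ε i)}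

/-- The expected excess load at an endpoint of `e`, on the event that `e` is in the output. -/
theorem HasColor.sum_edgeIndicator_mul_excess_le (hx : IsFractionalMatching G x) (hε : 0 < ε)
    (hd : 0 < d) (hdε : 2 / d ≤ ε ^ 2) (hγ : 1 ≤ γ) {e : Sym2 V}
    {c : Σ i : Level n ε, Fin (numColors γ ε i)} (h : HasColor χ e c) {v : V} (hv : v ∈ e) :
    ∑ S ∈ outcomes n γ d ε, edgeIndicator χ e S *
        max (load (inverseWeight G x n γ d ε) (output G x χ S) v - 1) 0 ≤
      (ε ^ 2 + ε) * ∑ S ∈ outcomes n γ d ε, edgeIndicator χ e S := by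
  classical
  -- Edges in no class have weight zero, so restricting to colored edges leaves the load unchanged.
  set F : Finset (Sym2 V) := {f | v ∈ f ∧ ∃ c, HasColor χ f c} with hF
  have hFv : ∀ f ∈ F, v ∈ f := fun f hf => (mem_filter.1 hf).2.1
  have hFc : ∀ f ∈ F, ∃ c, HasColor χ f c := fun f hf => (mem_filter.1 hf).2.2
  have hload : ∀ S, load (inverseWeight G x n γ d ε) (output G x χ S) v =
      ∑ f ∈ F, inverseWeight G x n γ d ε f * edgeIndicator χ f S := by
    intro S
    symm
    refine sum_subset (fun f hf => by simpa using hFv f hf) fun f hf hf' => ?_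
    by_contra hne
    refine hf' (mem_filter.2 ⟨mem_univ _, (mem_filter.1 hf).2, ?_⟩)
    exact exists_hasColor_of_inverseWeight_ne_zero χ (left_ne_zero_of_mul hne)
  simp only [hload]
  refine sum_mul_excess_le _ F (edgeIndicator χ) x _ e
    (mem_filter.2 ⟨mem_univ _, hv, c, h⟩) (2 / d) ε hε hdε (by positivity)
    (fun f _ S => edgeIndicator_eq_zero_or_one f S) (fun f _ => hx.nonneg f) ?_
    (fun f _ => inverseWeight_nonneg hx.nonneg f) ?_ ?_ (h.sum_edgeIndicator_pos hε hd hγ) ?_ ?_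
  · exact (sum_le_sum_of_subset_of_nonneg (fun f hf => by simpa using hFv f hf)
      fun f _ _ => hx.nonneg f).trans (hx.sum_le_one v)
  · intro f hf
    obtain ⟨c', h'⟩ := hFc f hf
    exact h'.inverseWeight_mul_sum hε hd hγ
  · intro f hf
    obtain ⟨c', h'⟩ := hFc f hf
    by_cases hc : numSamples γ d ε c'.1 = numColors γ ε c'.1
    · exact .inl fun S hS => h'.edgeIndicator_eq_one hε hc hS
    · exact .inr (h'.inverseWeight_le hε hd hγ hc)
  · intro f hf hfe
    obtain ⟨c', h'⟩ := hFc f hf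
    have hne := h'.ne h hfe (hFv f hf) hv
    rw [h.sum_edgeIndicator_mul hε h', h.sum_edgeIndicator hε, h'.sum_edgeIndicator hε,
      ← sampleCount_empty, mul_comm (sampleCount d {c} : ℝ)]
    exact_mod_cast superCount_mul_le (fun i : Level n ε => numSamples γ d ε i) ∅
      (notMem_empty c') (notMem_empty c) hne
  · intro f hf g hg hfe hge hfg
    obtain ⟨c', h'⟩ := hFc f hf
    obtain ⟨c'', h''⟩ := hFc g hg
    rw [h.sum_edgeIndicator_mul_mul hε h' h'', h.sum_edgeIndicator_mul hε h',
      h.sum_edgeIndicator_mul hε h'', h.sum_edgeIndicator hε]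
    exact_mod_cast superCount_mul_le (fun i : Level n ε => numSamples γ d ε i) {c}
      (by simpa using h'.ne h hfe (hFv f hf) hv) (by simpa using h''.ne h hge (hFv g hg) hv)
      (h'.ne h'' hfg (hFv f hf) (hFv g hg))

theorem card_filter_mem_le_two (e : Sym2 V) : #{v | v ∈ e} ≤ 2 := by
  induction e with
  | _ a b =>
    refine le_trans (card_le_card (t := {a, b}) fun v hv => ?_) card_le_two
    simpa using hv

theorem HasColor.le_expectation_scaledWeight (hx : IsFractionalMatching G x) (hε : 0 < ε)
    (hε₁ : ε < 1 / 2) (hd : 0 < d) (hdε : 2 / d ≤ ε ^ 2) (hγ : 1 ≤ γ) {e : Sym2 V}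
    {c : Σ i : Level n ε, Fin (numColors γ ε i)} (h : HasColor χ e c) :
    (1 - 6 * ε) * x e ≤ expectation (outputLaw G x d χ)
      (fun H => scaledWeight (inverseWeight G x n γ d ε) H e) := by
  set w := inverseWeight G x n γ d ε with hw
  have hw0 : ∀ e, 0 ≤ w e := inverseWeight_nonneg hx.nonneg
  have hN : (0 : ℝ) < #(outcomes n γ d ε) := by
    exact_mod_cast (outcomes_nonempty n γ d ε).card_pos
  set A := ∑ S ∈ outcomes n γ d ε, edgeIndicator χ e S with hA
  have hApos : 0 < A := h.sum_edgeIndicator_pos hε hd hγ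
  have hexcess : ∑ v with v ∈ e, ∑ S ∈ outcomes n γ d ε,
      edgeIndicator χ e S * max (load w (output G x χ S) v - 1) 0 ≤ 2 * ((ε ^ 2 + ε) * A) := by
    calc _ ≤ ∑ v with v ∈ e, (ε ^ 2 + ε) * A := sum_le_sum fun v hv =>
          h.sum_edgeIndicator_mul_excess_le hx hε hd hdε hγ (by simpa using hv)
      _ ≤ 2 * ((ε ^ 2 + ε) * A) := by
        rw [sum_const, nsmul_eq_mul]
        have : (#{v | v ∈ e} : ℝ) ≤ 2 := by exact_mod_cast card_filter_mem_le_two e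
        gcongr
  rw [expectation_outputLaw, le_div_iff₀ hN]
  calc (1 - 6 * ε) * x e * #(outcomes n γ d ε)
      = (w e * A) * (1 - 6 * ε) := by rw [hw, hA, h.inverseWeight_mul_sum hε hd hγ]; ring
    _ ≤ (w e * A) * (1 - 2 * (ε ^ 2 + ε)) :=
        mul_le_mul_of_nonneg_left (by nlinarith) (mul_nonneg (hw0 e) hApos.le)
    _ ≤ w e * (A - ∑ v with v ∈ e, ∑ S ∈ outcomes n γ d ε,
          edgeIndicator χ e S * max (load w (output G x χ S) v - 1) 0) := by
        rw [mul_assoc]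
        exact mul_le_mul_of_nonneg_left (by linarith) (hw0 e)
    _ = ∑ S ∈ outcomes n γ d ε, w e * (edgeIndicator χ e S - ∑ v with v ∈ e,
          edgeIndicator χ e S * max (load w (output G x χ S) v - 1) 0) := by
        rw [sum_comm, hA, ← sum_sub_distrib, mul_sum]
    _ ≤ ∑ S ∈ outcomes n γ d ε, scaledWeight w (output G x χ S) e := by
        refine sum_le_sum fun S _ => le_scaledWeight w hw0 _ e _
          (edgeIndicator_eq_zero_or_one e S) fun h1 => ?_
        by_contra hne
        simp [edgeIndicator, hne] at h1

theorem IsFractionalMatching.le_one (hx : IsFractionalMatching G x) (e : Sym2 V) : x e ≤ 1 := by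
  induction e with
  | _ a b =>
    exact (single_le_sum (f := x) (fun f _ => hx.nonneg f) (by simp)).trans (hx.sum_le_one a)

theorem exists_hasColor (hx : IsFractionalMatching G x) (hε : 0 < ε)
    (χ : ∀ i : Level n ε, EdgeColoring (levelGraph G x ε i) (numColors γ ε i)) {e : Sym2 V}
    (he : (1 + ε) ^ (-(numLevels n ε : ℤ)) < x e) : ∃ c, HasColor χ e c := by
  have hpos : 0 < x e := lt_trans (by positivity) he
  have hG : e ∈ G.edgeSet := by
    by_contra hne
    exact hpos.ne' (hx.eq_zero_of_notMem e hne)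
  obtain ⟨i, hi, hei⟩ := exists_level hε hG (hx.le_one e) he
  exact ⟨⟨⟨i, hi⟩, χ ⟨i, hi⟩ ⟨e, mem_edgeSet_levelGraph.2 hei⟩⟩, mem_edgeSet_levelGraph.2 hei, rfl⟩

/-- The second moment argument needs only `d ≥ 2 / ε ^ 2`, and the logarithm is at least log 2 >
1/2. -/
theorem two_div_le_sq (hε₀ : 0 < ε) (hε₁ : ε < 1 / 2) (hd : 4 * Real.log (2 / ε) / ε ^ 2 ≤ d) :
    0 < d ∧ 2 / d ≤ ε ^ 2 := by
  have hlog : 1 / 2 ≤ Real.log (2 / ε) := by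
    have h2 : (2 : ℝ) ≤ 2 / ε := by rw [le_div_iff₀ hε₀]; linarith
    linarith [Real.log_two_gt_d9, Real.log_le_log two_pos h2]
  have h : 2 / ε ^ 2 ≤ d := le_trans (by gcongr; linarith) hd
  have hd0 : 0 < d := lt_of_lt_of_le (by positivity) h
  refine ⟨hd0, ?_⟩
  rw [div_le_iff₀ (by positivity)] at h
  rw [div_le_iff₀ hd0]
  linarith

end Expectation

end EdgeColorSparsify

/-! ### Summation over the edges. -/

open EdgeColorSparsify in
theorem mainTheorem7 {V : Type*} [Fintype V] [DecidableEq V] (G : SimpleGraph V)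
    (x : Sym2 V → ℝ) (hx : IsFractionalMatching G x)
    (ε d : ℝ) (hε₀ : 0 < ε) (hε₁ : ε < 1 / 2) (hd : 4 * Real.log (2 / ε) / ε ^ 2 ≤ d)
    (γ : ℕ) (hγ : 1 ≤ γ)
    (χ : ∀ i : Level (Fintype.card V) ε,
      EdgeColoring (levelGraph G x ε i) (numColors γ ε i)) :
    ∃ y : SimpleGraph V → Sym2 V → ℝ,
      (∀ H, IsFractionalMatching H (y H)) ∧
      (∀ e, (1 + ε) ^ (-(numLevels (Fintype.card V) ε : ℤ)) < x e →
        (1 - 6 * ε) * x e ≤ expectation (outputLaw G x d χ) (fun H => y H e)) ∧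
      (1 - 6 * ε) *
          ∑ e : Sym2 V with (1 + ε) ^ (-(numLevels (Fintype.card V) ε : ℤ)) < x e, x e ≤
        expectation (outputLaw G x d χ) (fun H => ∑ e, y H e) ∧
      (1 - 6 * ε) * ∑ e, x e - ε ^ 2 ≤
        expectation (outputLaw G x d χ) (fun H => ∑ e, y H e) := by
  obtain ⟨hd0, hdε⟩ := two_div_le_sq hε₀ hε₁ hd
  set y := scaledWeight (inverseWeight G x (Fintype.card V) γ d ε) with hy
  have hmatch : ∀ H, IsFractionalMatching H (y H) :=
    isFractionalMatching_scaledWeight _ (inverseWeight_nonneg hx.nonneg)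
  have hedge : ∀ e, (1 + ε) ^ (-(numLevels (Fintype.card V) ε : ℤ)) < x e →
      (1 - 6 * ε) * x e ≤ expectation (outputLaw G x d χ) (fun H => y H e) := by
    intro e he
    obtain ⟨c, h⟩ := exists_hasColor hx hε₀ χ he
    exact h.le_expectation_scaledWeight hx hε₀ hε₁ hd0 hdε hγ
  have hsum : expectation (outputLaw G x d χ) (fun H => ∑ e, y H e) =
      ∑ e, expectation (outputLaw G x d χ) (fun H => y H e) := by
    simp only [expectation_outputLaw]
    rw [Finset.sum_comm, Finset.sum_div]
  have hnonneg : ∀ e, 0 ≤ expectation (outputLaw G x d χ) (fun H => y H e) := by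
    intro e
    rw [expectation_outputLaw]
    exact div_nonneg (Finset.sum_nonneg fun S _ => (hmatch _).nonneg e) (Nat.cast_nonneg _)
  have hlarge : (1 - 6 * ε) *
      ∑ e : Sym2 V with (1 + ε) ^ (-(numLevels (Fintype.card V) ε : ℤ)) < x e, x e ≤
        expectation (outputLaw G x d χ) (fun H => ∑ e, y H e) := by
    rw [hsum, Finset.mul_sum]
    exact (Finset.sum_le_sum fun e he => hedge e (Finset.mem_filter.1 he).2).trans
      (Finset.sum_le_sum_of_subset_of_nonneg (Finset.filter_subset _ _) fun e _ _ => hnonneg e)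
  refine ⟨y, hmatch, hedge, hlarge, ?_⟩
  have hsmall := sum_small_le (x := x) hε₀
  have hsmall0 : 0 ≤ ∑ e : Sym2 V with
      ¬ (1 + ε) ^ (-(numLevels (Fintype.card V) ε : ℤ)) < x e, x e :=
    Finset.sum_nonneg fun e _ => hx.nonneg e
  rw [← Finset.sum_filter_add_sum_filter_not Finset.univ
    (fun e => (1 + ε) ^ (-(numLevels (Fintype.card V) ε : ℤ)) < x e) x, mul_add]
  -- The leftover edges have total value in `[0, ε ^ 2]`, and `1 - 6 * ε ≤ 1`, possibly negative.
  nlinarith
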